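/- Let $\mathbb{D}$ be the open unit disc of $\mathbb{C}$, and let $A$ be an analytic function in $\mathbb{D}$ with $A\in H^\infty_2$, that is, $\sup_{z\in\mathbb{D}}(1-|z|^2)^2|A(z)|<\infty$. Let $f\not\equiv 0$ be an analytic solution of $f''+Af=0$ in $\mathbb{D}$, and let $\{z_n\}$ be the (finite or infinite, possibly empty) sequence of all zeros of $f$ in $\mathbb{D}$; a supremum over the empty set is regarded as finite. Then the following conditions are equivalent: (i) $f$ is normal in the sense of Lehto and Virtanen, that is, $\displaystyle\sup_{z\in\mathbb{D}}\,(1-|z|^2)\,\frac{|f'(z)|}{1+|f(z)|^2}<\infty$; (ii) $\displaystyle\sup_{n}\,(1-|z_n|^2)\,|f'(z_n)|<\infty$; (iii) there exists a constant $c$ with $0<c<1$ such that $f$ is uniformly bounded in $\bigcup_{n} D\big(z_n,c(1-|z_n|)\big)$, where $D(a,r)=\{z\in\mathbb{C}:|z-a|<r\}$. -/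

import Mathlib

namespace NormalODE

/-- The open unit disc of the complex plane. -/
def disc : Set ℂ := Metric.ball (0 : ℂ) 1

/-- Membership of `A` in the growth space `H^∞_α`: `A` is analytic in the unit disc and
`(1 - |z|²)^α |A(z)|` is bounded there. Only the values of `A` in the disc matter. -/
def MemGrowthSpace (α : ℝ) (A : ℂ → ℂ) : Prop :=
  DifferentiableOn ℂ A disc ∧
    BddAbove ((fun z : ℂ => (1 - ‖z‖ ^ 2) ^ α * ‖A z‖) '' disc)

/-- `f` is an analytic solution of `f'' + A f = 0` in the unit disc. -/
def IsSolution (A f : ℂ → ℂ) : Prop :=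
  DifferentiableOn ℂ f disc ∧
    ∀ z ∈ disc, deriv (deriv f) z + A z * f z = 0

/-- The set of zeros of `f` in the unit disc. -/
def zeros (f : ℂ → ℂ) : Set ℂ := {z | z ∈ disc ∧ f z = 0}

/-- A meromorphic function `f` in the unit disc is normal in the sense of Lehto and Virtanen if
`(1 - |z|²) |f'(z)| / (1 + |f(z)|²)` is bounded in the disc. The bound is required at the points
of analyticity of `f`; the remaining points are isolated, and the quantity extends to them
continuously, so that they do not change the supremum. -/
def IsNormalFunction (f : ℂ → ℂ) : Prop :=
  MeromorphicOn f disc ∧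
    BddAbove ((fun z : ℂ => (1 - ‖z‖ ^ 2) * (‖deriv f z‖ / (1 + ‖f z‖ ^ 2))) ''
      {z | z ∈ disc ∧ AnalyticAt ℂ f z})

end NormalODE

/-!
The derivative of a solution at a zero controls, and is controlled by, its size near that zero:
one direction is the Schwarz lemma, the other a Taylor estimate for the equation. Indeed
`A ∈ H^∞_2` makes `f''` small against `f` on every disc `D(a, δ(1 - |a|))` with `δ` small, so
there `f` is uniformly close to its first-order Taylor polynomial at `a`. For normality let `a` be
arbitrary. If `δ(1 - |a|)|f'(a)| ≤ 3|f(a)|`, the spherical derivative is bounded at `a` because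
`2|f(a)| ≤ 1 + |f(a)|²`. Otherwise the Taylor polynomial vanishes well inside the disc, hence `f`
has a zero `b` in it, and `f'` varies so little that the bound on `f'(b)` transfers to `f'(a)`.
-/

open Metric Set

namespace NormalODE

section NearlyAffine

variable {𝕜 E : Type*} [RCLike 𝕜] [NormedAddCommGroup E] [NormedSpace 𝕜 E]
  {f : 𝕜 → E} {a z : 𝕜} {R : ℝ}

lemma norm_sub_sub_smul_deriv_le_of_convex {s : Set 𝕜} {M : ℝ} (hs : Convex ℝ s)
    (hf : ∀ x ∈ s, DifferentiableAt 𝕜 f x) (hf' : ∀ x ∈ s, DifferentiableAt 𝕜 (deriv f) x)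
    (hM : ∀ x ∈ s, ‖deriv (deriv f) x‖ ≤ M) (ha : a ∈ s) (hz : z ∈ s) :
    ‖f z - f a - (z - a) • deriv f a‖ ≤ M * ‖z - a‖ ^ 2 := by
  have hM0 : 0 ≤ M := (norm_nonneg _).trans (hM a ha)
  have hseg : segment ℝ a z ⊆ s := hs.segment_subset ha hz
  have hderiv : ∀ x ∈ segment ℝ a z,
      HasDerivWithinAt (fun x ↦ f x - x • deriv f a) (deriv f x - deriv f a) (segment ℝ a z) x :=
    fun x hx ↦ ((hf x (hseg hx)).hasDerivAt.sub
      (by simpa only [one_smul] using (hasDerivAt_id' x).smul_const (deriv f a))).hasDerivWithinAt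
  have hbound : ∀ x ∈ segment ℝ a z, ‖deriv f x - deriv f a‖ ≤ M * ‖z - a‖ := fun x hx ↦
    calc ‖deriv f x - deriv f a‖ ≤ M * ‖x - a‖ :=
          hs.norm_image_sub_le_of_norm_deriv_le hf' hM ha (hseg hx)
      _ ≤ M * ‖z - a‖ := by gcongr; exact norm_sub_le_of_mem_segment hx
  calc ‖f z - f a - (z - a) • deriv f a‖
      = ‖f z - z • deriv f a - (f a - a • deriv f a)‖ := by congr 1; module
    _ ≤ M * ‖z - a‖ * ‖z - a‖ := (convex_segment a z).norm_image_sub_le_of_norm_hasDerivWithin_le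
        hderiv hbound (left_mem_segment ℝ a z) (right_mem_segment ℝ a z)
    _ = M * ‖z - a‖ ^ 2 := by ring

/-- The size of the first-order jet of `f` at `a`, measured at scale `R`: the supremum over the
disc `closedBall a R` of the norm of a first-order Taylor polynomial is at most this number. -/
noncomputable def jetNorm (f : 𝕜 → E) (a : 𝕜) (R : ℝ) : ℝ := ‖f a‖ + R * ‖deriv f a‖

/-- `f` is twice differentiable on `closedBall a R`, and `f''` is so small against `f` there that
`f` stays close to its first-order Taylor polynomial at `a`. The factor `R ^ 2` makes the notion
invariant under affine changes of variable; the constant `8` leaves enough room to locate zeros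
of `f`. -/
structure IsNearlyAffine (f : 𝕜 → E) (a : 𝕜) (R : ℝ) : Prop where
  radius_pos : 0 < R
  differentiableAt : ∀ z ∈ closedBall a R, DifferentiableAt 𝕜 f z
  differentiableAt_deriv : ∀ z ∈ closedBall a R, DifferentiableAt 𝕜 (deriv f) z
  norm_deriv_deriv_le_norm : ∀ z ∈ closedBall a R, 8 * R ^ 2 * ‖deriv (deriv f) z‖ ≤ ‖f z‖

namespace IsNearlyAffine

lemma norm_sub_sub_smul_deriv_le (h : IsNearlyAffine f a R) {M : ℝ}
    (hM : ∀ x ∈ closedBall a R, R ^ 2 * ‖deriv (deriv f) x‖ ≤ M) (hz : z ∈ closedBall a R) :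
    ‖f z - f a - (z - a) • deriv f a‖ ≤ M := by
  have hR := h.radius_pos
  have ha : a ∈ closedBall a R := mem_closedBall_self hR.le
  have hM' : ∀ x ∈ closedBall a R, ‖deriv (deriv f) x‖ ≤ M / R ^ 2 := fun x hx ↦ by
    rw [le_div_iff₀' (by positivity)]
    exact hM x hx
  have hM0 : 0 ≤ M / R ^ 2 := (norm_nonneg _).trans (hM' a ha)
  calc ‖f z - f a - (z - a) • deriv f a‖
      ≤ M / R ^ 2 * ‖z - a‖ ^ 2 := norm_sub_sub_smul_deriv_le_of_convex (convex_closedBall a R)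
        h.differentiableAt h.differentiableAt_deriv hM' ha hz
    _ ≤ M / R ^ 2 * R ^ 2 := by gcongr; exact mem_closedBall_iff_norm.1 hz
    _ = M := by field_simp

lemma norm_le_two_mul_jetNorm (h : IsNearlyAffine f a R) (hz : z ∈ closedBall a R) :
    ‖f z‖ ≤ 2 * jetNorm f a R := by
  have hcont : ContinuousOn f (closedBall a R) := fun x hx ↦
    (h.differentiableAt x hx).continuousAt.continuousWithinAt
  obtain ⟨w, hw, hmax⟩ := (isCompact_closedBall a R).exists_isMaxOn ⟨z, hz⟩ hcont.norm
  have hrem : ‖f w - f a - (w - a) • deriv f a‖ ≤ ‖f w‖ / 8 :=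
    h.norm_sub_sub_smul_deriv_le (fun x hx ↦ by
      linarith [h.norm_deriv_deriv_le_norm x hx, isMaxOn_iff.1 hmax x hx]) hw
  have hlin : ‖(w - a) • deriv f a‖ ≤ R * ‖deriv f a‖ := by
    rw [norm_smul]
    gcongr
    exact mem_closedBall_iff_norm.1 hw
  have hmax_le : ‖f w‖ ≤ ‖f w‖ / 8 + jetNorm f a R :=
    calc ‖f w‖ = ‖f w - f a - (w - a) • deriv f a + f a + (w - a) • deriv f a‖ := by
          congr 1; abel
      _ ≤ ‖f w‖ / 8 + ‖f a‖ + R * ‖deriv f a‖ := norm_add₃_le.trans (by gcongr)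
      _ = ‖f w‖ / 8 + jetNorm f a R := by rw [jetNorm, add_assoc]
  linarith [isMaxOn_iff.1 hmax z hz, norm_nonneg (f w)]

lemma norm_deriv_deriv_le (h : IsNearlyAffine f a R) (hz : z ∈ closedBall a R) :
    R ^ 2 * ‖deriv (deriv f) z‖ ≤ jetNorm f a R / 4 := by
  linarith [h.norm_deriv_deriv_le_norm z hz, h.norm_le_two_mul_jetNorm hz]

lemma norm_deriv_sub_le (h : IsNearlyAffine f a R) (hz : z ∈ closedBall a R) :
    R * ‖deriv f z - deriv f a‖ ≤ jetNorm f a R / 4 := by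
  have hR := h.radius_pos
  have hbound : ∀ x ∈ closedBall a R, ‖deriv (deriv f) x‖ ≤ jetNorm f a R / 4 / R ^ 2 :=
    fun x hx ↦ by
      rw [le_div_iff₀' (by positivity)]
      exact h.norm_deriv_deriv_le hx
  have ha : a ∈ closedBall a R := mem_closedBall_self hR.le
  have hbound0 : 0 ≤ jetNorm f a R / 4 / R ^ 2 := (norm_nonneg _).trans (hbound a ha)
  calc R * ‖deriv f z - deriv f a‖
      ≤ R * (jetNorm f a R / 4 / R ^ 2 * ‖z - a‖) := by
        gcongr
        exact (convex_closedBall a R).norm_image_sub_le_of_norm_deriv_le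
          h.differentiableAt_deriv hbound ha hz
    _ ≤ R * (jetNorm f a R / 4 / R ^ 2 * R) := by gcongr; exact mem_closedBall_iff_norm.1 hz
    _ = jetNorm f a R / 4 := by field_simp

end IsNearlyAffine

end NearlyAffine

section Zeros

variable {f : ℂ → ℂ} {a : ℂ} {R : ℝ}

lemma exists_zero_of_norm_sub_sub_smul_deriv_le {ε : ℝ} (hf : DiffContOnCl ℂ f (ball a R))
    (hR : 0 < R) (hε : ∀ z ∈ sphere a R, ‖f z - f a - (z - a) • deriv f a‖ ≤ ε)
    (hdom : 2 * ‖f a‖ + ε < R * ‖deriv f a‖) : ∃ b ∈ closedBall a R, f b = 0 := by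
  have hε0 : 0 ≤ ε := by
    obtain ⟨w, hw⟩ := (NormedSpace.sphere_nonempty (x := a)).2 hR.le
    exact (norm_nonneg _).trans (hε w hw)
  have hsphere : ∀ z ∈ sphere a R, R * ‖deriv f a‖ - ε ≤ ‖f z - f a‖ := fun z hz ↦ by
    have hlin : ‖(z - a) • deriv f a‖ = R * ‖deriv f a‖ := by
      rw [norm_smul, mem_sphere_iff_norm.1 hz]
    linarith [hε z hz, norm_sub_norm_le ((z - a) • deriv f a) (f z - f a),
      norm_sub_rev ((z - a) • deriv f a) (f z - f a)]
  have hnonconst : ∃ᶠ z in nhds a, f z ≠ f a := fun hconst ↦ by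
    have hderiv : deriv f a = 0 := by
      rw [Filter.EventuallyEq.deriv_eq (hconst.mono fun _ ↦ not_not.1), deriv_const]
    rw [hderiv, norm_zero, mul_zero] at hdom
    linarith [norm_nonneg (f a)]
  have hmem : (0 : ℂ) ∈ ball (f a) ((R * ‖deriv f a‖ - ε) / 2) := by
    rw [mem_ball, dist_zero_left]
    linarith
  exact hf.ball_subset_image_closedBall hR hsphere hnonconst hmem

lemma IsNearlyAffine.exists_zero_norm_deriv_le (h : IsNearlyAffine f a R)
    (hdom : 3 * ‖f a‖ < R * ‖deriv f a‖) :
    ∃ b ∈ closedBall a R, f b = 0 ∧ ‖deriv f a‖ ≤ 2 * ‖deriv f b‖ := by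
  have hR := h.radius_pos
  have hjet : jetNorm f a R < 4 / 3 * (R * ‖deriv f a‖) := by
    unfold jetNorm
    linarith
  have hdiff : DiffContOnCl ℂ f (ball a R) := DifferentiableOn.diffContOnCl fun z hz ↦
    (h.differentiableAt z (closure_ball_subset_closedBall hz)).differentiableWithinAt
  obtain ⟨b, hb, hfb⟩ := exists_zero_of_norm_sub_sub_smul_deriv_le hdiff hR
    (fun z hz ↦ h.norm_sub_sub_smul_deriv_le (fun _ ↦ h.norm_deriv_deriv_le)
      (sphere_subset_closedBall hz))
    (by linarith)
  have hvar : ‖deriv f b - deriv f a‖ ≤ 1 / 3 * ‖deriv f a‖ :=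
    le_of_mul_le_mul_left (by linarith [h.norm_deriv_sub_le hb]) hR
  refine ⟨b, hb, hfb, ?_⟩
  linarith [norm_sub_norm_le (deriv f a) (deriv f b), norm_sub_rev (deriv f a) (deriv f b),
    norm_nonneg (deriv f a)]

end Zeros

section Disc

variable {a z : ℂ} {δ : ℝ}

lemma isOpen_disc : IsOpen disc := isOpen_ball

lemma one_sub_norm_pos (hz : z ∈ disc) : 0 < 1 - ‖z‖ :=
  sub_pos.2 (mem_ball_zero_iff.1 hz)

lemma one_sub_norm_le_one_sub_norm_sq (hz : z ∈ disc) : 1 - ‖z‖ ≤ 1 - ‖z‖ ^ 2 := by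
  nlinarith [norm_nonneg z, one_sub_norm_pos hz]

lemma one_sub_norm_sq_le_two_mul (z : ℂ) : 1 - ‖z‖ ^ 2 ≤ 2 * (1 - ‖z‖) := by
  nlinarith [sq_nonneg (1 - ‖z‖)]

lemma one_sub_norm_le_two_mul_of_mem_closedBall (ha : a ∈ disc) (hδ : δ ≤ 1 / 2)
    (hz : z ∈ closedBall a (δ * (1 - ‖a‖))) : 1 - ‖a‖ ≤ 2 * (1 - ‖z‖) := by
  nlinarith [mem_closedBall_iff_norm.1 hz, norm_sub_norm_le z a, one_sub_norm_pos ha]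

lemma closedBall_subset_disc (ha : a ∈ disc) (hδ : δ ≤ 1 / 2) :
    closedBall a (δ * (1 - ‖a‖)) ⊆ disc := fun z hz ↦ by
  rw [disc, mem_ball_zero_iff]
  linarith [one_sub_norm_pos ha, one_sub_norm_le_two_mul_of_mem_closedBall ha hδ hz]

lemma ball_subset_disc (hδ : δ ≤ 1) (ha : a ∈ disc) : ball a (δ * (1 - ‖a‖)) ⊆ disc :=
  ball_subset_ball' (by
    rw [dist_zero_right]
    nlinarith [one_sub_norm_pos ha])

end Disc

lemma IsSolution.exists_norm_deriv_deriv_le {A f : ℂ → ℂ} (hA : MemGrowthSpace 2 A)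
    (hf : IsSolution A f) :
    ∃ K : ℝ, ∀ z ∈ disc, (1 - ‖z‖ ^ 2) ^ 2 * ‖deriv (deriv f) z‖ ≤ K * ‖f z‖ := by
  obtain ⟨K, hK⟩ := hA.2
  refine ⟨K, fun z hz ↦ ?_⟩
  have hAz : (1 - ‖z‖ ^ 2) ^ 2 * ‖A z‖ ≤ K := by simpa using hK (mem_image_of_mem _ hz)
  calc (1 - ‖z‖ ^ 2) ^ 2 * ‖deriv (deriv f) z‖ = (1 - ‖z‖ ^ 2) ^ 2 * ‖A z‖ * ‖f z‖ := by
        rw [eq_neg_of_add_eq_zero_left (hf.2 z hz), norm_neg, norm_mul, mul_assoc]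
    _ ≤ K * ‖f z‖ := by gcongr

section VectorValued

variable {E : Type*} [NormedAddCommGroup E] [NormedSpace ℂ E] {f : ℂ → E} {a z : ℂ}

lemma exists_isNearlyAffine [CompleteSpace E] {K : ℝ} (hf : DifferentiableOn ℂ f disc)
    (hK : ∀ z ∈ disc, (1 - ‖z‖ ^ 2) ^ 2 * ‖deriv (deriv f) z‖ ≤ K * ‖f z‖) :
    ∃ δ ≤ (1 / 2 : ℝ), ∀ a ∈ disc, IsNearlyAffine f a (δ * (1 - ‖a‖)) := by
  set δ : ℝ := 1 / (8 * (1 + |K|)) with hδ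
  have hδ0 : 0 < δ := by positivity
  have hδK : 8 * δ * (1 + |K|) = 1 := by rw [hδ]; field_simp
  have hδ_half : δ ≤ 1 / 2 := by nlinarith [abs_nonneg K]
  refine ⟨δ, hδ_half, fun a ha ↦ ?_⟩
  have ha0 := one_sub_norm_pos ha
  have hsub := closedBall_subset_disc ha hδ_half
  refine ⟨by positivity, fun z hz ↦ hf.differentiableAt (isOpen_disc.mem_nhds (hsub hz)),
    fun z hz ↦ (hf.deriv isOpen_disc).differentiableAt (isOpen_disc.mem_nhds (hsub hz)),
    fun z hz ↦ ?_⟩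
  have hweight : 1 - ‖a‖ ≤ 2 * (1 - ‖z‖ ^ 2) := by
    linarith [one_sub_norm_le_two_mul_of_mem_closedBall ha hδ_half hz,
      one_sub_norm_le_one_sub_norm_sq (hsub hz)]
  have hf_second : (1 - ‖z‖ ^ 2) ^ 2 * ‖deriv (deriv f) z‖ ≤ |K| * ‖f z‖ :=
    (hK z (hsub hz)).trans (by gcongr; exact le_abs_self K)
  have hsmall : 32 * δ ^ 2 * |K| ≤ 1 := by nlinarith [abs_nonneg K]
  calc 8 * (δ * (1 - ‖a‖)) ^ 2 * ‖deriv (deriv f) z‖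
      ≤ 8 * (δ * (2 * (1 - ‖z‖ ^ 2))) ^ 2 * ‖deriv (deriv f) z‖ := by gcongr
    _ = 32 * δ ^ 2 * ((1 - ‖z‖ ^ 2) ^ 2 * ‖deriv (deriv f) z‖) := by ring
    _ ≤ 32 * δ ^ 2 * (|K| * ‖f z‖) := mul_le_mul_of_nonneg_left hf_second (by positivity)
    _ = 32 * δ ^ 2 * |K| * ‖f z‖ := by ring
    _ ≤ ‖f z‖ := mul_le_of_le_one_left (norm_nonneg _) hsmall

lemma norm_le_of_isNearlyAffine_of_eq_zero {δ : ℝ} (hδ : δ ≤ 1 / 2)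
    (h : IsNearlyAffine f a (δ * (1 - ‖a‖))) (ha : a ∈ disc) (hfa : f a = 0)
    (hz : z ∈ closedBall a (δ * (1 - ‖a‖))) : ‖f z‖ ≤ (1 - ‖a‖ ^ 2) * ‖deriv f a‖ := by
  have ha0 := one_sub_norm_pos ha
  calc ‖f z‖ ≤ 2 * jetNorm f a (δ * (1 - ‖a‖)) := h.norm_le_two_mul_jetNorm hz
    _ = 2 * δ * (1 - ‖a‖) * ‖deriv f a‖ := by rw [jetNorm, hfa, norm_zero]; ring
    _ ≤ 1 * (1 - ‖a‖) * ‖deriv f a‖ := by gcongr; linarith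
    _ = (1 - ‖a‖) * ‖deriv f a‖ := by rw [one_mul]
    _ ≤ (1 - ‖a‖ ^ 2) * ‖deriv f a‖ :=
        mul_le_mul_of_nonneg_right (one_sub_norm_le_one_sub_norm_sq ha) (norm_nonneg _)

lemma norm_deriv_le_of_norm_le_of_eq_zero {c C : ℝ} (hf : DifferentiableOn ℂ f disc)
    (hc : 0 < c) (hc1 : c ≤ 1) (ha : a ∈ disc) (hfa : f a = 0)
    (hC : ∀ z ∈ ball a (c * (1 - ‖a‖)), ‖f z‖ ≤ C) :
    (1 - ‖a‖ ^ 2) * ‖deriv f a‖ ≤ 2 * C / c := by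
  have ha0 := one_sub_norm_pos ha
  have hmaps : MapsTo f (ball a (c * (1 - ‖a‖))) (closedBall (f a) C) := fun z hz ↦ by
    simpa only [hfa, mem_closedBall_zero_iff] using hC z hz
  calc (1 - ‖a‖ ^ 2) * ‖deriv f a‖ ≤ 2 * (1 - ‖a‖) * (C / (c * (1 - ‖a‖))) := by
        gcongr
        · exact one_sub_norm_sq_le_two_mul a
        · exact Complex.norm_deriv_le_div_of_mapsTo_ball (hf.mono (ball_subset_disc hc1 ha)) hmaps
            (by positivity)
    _ = 2 * C / c := by field_simp

end VectorValued

section Normality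

variable {f : ℂ → ℂ} {a : ℂ} {δ : ℝ}

lemma norm_deriv_le_or_exists_zero (hδ : δ ≤ 1 / 2) (ha : a ∈ disc)
    (h : IsNearlyAffine f a (δ * (1 - ‖a‖))) :
    (1 - ‖a‖ ^ 2) * ‖deriv f a‖ ≤ 6 / δ * ‖f a‖ ∨
      ∃ b ∈ zeros f, (1 - ‖a‖ ^ 2) * ‖deriv f a‖ ≤ 8 * ((1 - ‖b‖ ^ 2) * ‖deriv f b‖) := by
  have ha0 := one_sub_norm_pos ha
  have hδ0 : 0 < δ := pos_of_mul_pos_left h.radius_pos ha0.le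
  have hweight : (1 - ‖a‖ ^ 2) * ‖deriv f a‖ ≤ 2 * (1 - ‖a‖) * ‖deriv f a‖ := by
    gcongr
    exact one_sub_norm_sq_le_two_mul a
  rcases le_or_gt (δ * (1 - ‖a‖) * ‖deriv f a‖) (3 * ‖f a‖) with hsmall | hlarge
  · refine .inl (hweight.trans ?_)
    rw [div_mul_eq_mul_div, le_div_iff₀ hδ0]
    linarith
  · obtain ⟨b, hb, hfb, hderiv⟩ := h.exists_zero_norm_deriv_le hlarge
    have hb_disc := closedBall_subset_disc ha hδ hb
    have hb0 := one_sub_norm_pos hb_disc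
    refine .inr ⟨b, ⟨hb_disc, hfb⟩, hweight.trans ?_⟩
    calc 2 * (1 - ‖a‖) * ‖deriv f a‖ ≤ 2 * (2 * (1 - ‖b‖)) * (2 * ‖deriv f b‖) := by
          gcongr
          exact one_sub_norm_le_two_mul_of_mem_closedBall ha hδ hb
      _ = (1 - ‖b‖) * (8 * ‖deriv f b‖) := by ring
      _ ≤ (1 - ‖b‖ ^ 2) * (8 * ‖deriv f b‖) :=
          mul_le_mul_of_nonneg_right (one_sub_norm_le_one_sub_norm_sq hb_disc) (by positivity)
      _ = 8 * ((1 - ‖b‖ ^ 2) * ‖deriv f b‖) := by ring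

lemma isNormalFunction_of_norm_deriv_le {B : ℝ} (hf : DifferentiableOn ℂ f disc)
    (hδ : δ ≤ 1 / 2) (h : ∀ a ∈ disc, IsNearlyAffine f a (δ * (1 - ‖a‖)))
    (hB : ∀ b ∈ zeros f, (1 - ‖b‖ ^ 2) * ‖deriv f b‖ ≤ B) : IsNormalFunction f := by
  refine ⟨fun z hz ↦ (hf.analyticAt (isOpen_disc.mem_nhds hz)).meromorphicAt,
    max (3 / δ) (8 * B), forall_mem_image.2 fun a ⟨ha, _⟩ ↦ ?_⟩
  have ha0 := one_sub_norm_pos ha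
  have hδ0 : 0 < δ := pos_of_mul_pos_left (h a ha).radius_pos ha0.le
  have ha_sq : 0 ≤ 1 - ‖a‖ ^ 2 := ha0.le.trans (one_sub_norm_le_one_sub_norm_sq ha)
  rw [← mul_div_assoc, le_max_iff]
  refine (norm_deriv_le_or_exists_zero hδ ha (h a ha)).imp (fun hle ↦ ?_)
    (fun ⟨b, hb, hle⟩ ↦ ?_)
  · rw [div_le_iff₀ (by positivity)]
    calc (1 - ‖a‖ ^ 2) * ‖deriv f a‖ ≤ 6 / δ * ‖f a‖ := hle
      _ = 3 / δ * (2 * 1 * ‖f a‖) := by ring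
      _ ≤ 3 / δ * (1 ^ 2 + ‖f a‖ ^ 2) := by gcongr; exact two_mul_le_add_sq 1 ‖f a‖
      _ = 3 / δ * (1 + ‖f a‖ ^ 2) := by rw [one_pow]
  · calc (1 - ‖a‖ ^ 2) * ‖deriv f a‖ / (1 + ‖f a‖ ^ 2) ≤ (1 - ‖a‖ ^ 2) * ‖deriv f a‖ :=
          div_le_self (by positivity) (le_add_of_nonneg_right (by positivity))
      _ ≤ 8 * B := by linarith [hB b hb]

lemma IsNormalFunction.exists_norm_deriv_le (h : IsNormalFunction f)
    (hf : DifferentiableOn ℂ f disc) :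
    ∃ B : ℝ, ∀ b ∈ zeros f, (1 - ‖b‖ ^ 2) * ‖deriv f b‖ ≤ B := by
  obtain ⟨B, hB⟩ := h.2
  exact ⟨B, fun b hb ↦ by
    simpa [hb.2] using
      hB (mem_image_of_mem _ ⟨hb.1, hf.analyticAt (isOpen_disc.mem_nhds hb.1)⟩)⟩

end Normality

end NormalODE

theorem mainTheorem7 (A f : ℂ → ℂ)
    (hA : NormalODE.MemGrowthSpace 2 A)
    (hf : NormalODE.IsSolution A f)
    (hnontrivial : ∃ z ∈ NormalODE.disc, f z ≠ 0) :
    List.TFAE [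
      NormalODE.IsNormalFunction f,
      BddAbove ((fun z : ℂ => (1 - ‖z‖ ^ 2) * ‖deriv f z‖) '' NormalODE.zeros f),
      ∃ c : ℝ, 0 < c ∧ c < 1 ∧ ∃ C : ℝ,
        ∀ z ∈ ⋃ a ∈ NormalODE.zeros f, Metric.ball a (c * (1 - ‖a‖)), ‖f z‖ ≤ C] := by
  obtain ⟨K, hK⟩ := hf.exists_norm_deriv_deriv_le hA
  obtain ⟨δ, hδ, hnear⟩ := NormalODE.exists_isNearlyAffine hf.1 hK
  tfae_have 1 → 2 := fun hnormal ↦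
    let ⟨B, hB⟩ := hnormal.exists_norm_deriv_le hf.1
    ⟨B, forall_mem_image.2 hB⟩
  tfae_have 2 → 1 := fun ⟨_, hB⟩ ↦
    NormalODE.isNormalFunction_of_norm_deriv_le hf.1 hδ hnear (forall_mem_image.1 hB)
  tfae_have 2 → 3 := by
    rintro ⟨B, hB⟩
    have hδ0 : 0 < δ := by simpa using (hnear 0 (mem_ball_self one_pos)).radius_pos
    refine ⟨δ, hδ0, by linarith, B, fun z hz ↦ ?_⟩
    obtain ⟨a, ha, hza⟩ := mem_iUnion₂.1 hz
    exact (NormalODE.norm_le_of_isNearlyAffine_of_eq_zero hδ (hnear a ha.1) ha.1 ha.2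
      (ball_subset_closedBall hza)).trans (forall_mem_image.1 hB ha)
  tfae_have 3 → 2 := fun ⟨c, hc, hc1, C, hC⟩ ↦ ⟨2 * C / c, forall_mem_image.2 fun _ ha ↦
    NormalODE.norm_deriv_le_of_norm_le_of_eq_zero hf.1 hc hc1.le ha.1 ha.2
      fun z hz ↦ hC z (mem_biUnion ha hz)⟩
  tfae_finish
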